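/- Let $n\ge 1$ and let $\{0,1\}^n$ be the discrete cube, viewed as a graph in which two vertices are adjacent iff they differ in exactly one coordinate. For a nonempty set $A\subseteq\{0,1\}^n$ let $\partial A$ be the set of edges between $A$ and its complement, for $x\in A$ let $d_{out}(x)$ be the number of neighbors of $x$ outside $A$, and let $d_A(x)$ be the degree of $x$ in the subgraph induced by $A$. Let $0\le\varepsilon'\le 1$ and $0<\delta\le 1$, put $$\varepsilon=\frac{\varepsilon'}{2n}\cdot\log_2\Bigl(\frac{2^n}{|A|}\Bigr),$$ and suppose that $$|\partial A|\le(1+\varepsilon)\cdot|A|\log_2\Bigl(\frac{2^n}{|A|}\Bigr).$$ Then for $x$ chosen uniformly at random from $A$, $$\Pr\Bigl\{(1-\delta)\log_2\Bigl(\frac{2^n}{|A|}\Bigr)\le d_{out}(x)\le(1+\varepsilon)(1+\delta)\log_2\Bigl(\frac{2^n}{|A|}\Bigr)\Bigr\}\ge 1-\frac{\varepsilon'}{\delta^2}.$$ In particular, the subgraph induced by $A$ is nearly regular, with almost all degrees close to $\log_2|A|$, in the sense that $$\Pr\Bigl\{\log_2|A|-\bigl((1+\varepsilon)(1+\delta)-1\bigr)\log_2\Bigl(\frac{2^n}{|A|}\Bigr)\le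 d_A(x)\le\log_2|A|+\delta\log_2\Bigl(\frac{2^n}{|A|}\Bigr)\Bigr\}\ge 1-\frac{\varepsilon'}{\delta^2}.$$ -/

import Mathlib

/-- The discrete cube `{0,1}^n` as a graph: two boolean strings of length `n` are connected by an
edge iff they differ in exactly one coordinate. -/
def cubeGraph (n : ℕ) : SimpleGraph (Fin n → Bool) where
  Adj x y := hammingDist x y = 1
  symm := ⟨fun x y h => by rw [hammingDist_comm]; exact h⟩
  loopless := ⟨fun x h => by simp at h⟩

/-- The edge boundary of `A`: the set of (unordered) edges of `G` between `A` and its complement. -/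
def edgeBoundary {V : Type*} (G : SimpleGraph V) (A : Set V) : Set (Sym2 V) :=
  {e | e ∈ G.edgeSet ∧ ∃ x ∈ A, ∃ y ∉ A, e = s(x, y)}

/-- The out-degree of `x` with respect to `A`: the number of neighbors of `x` outside `A`. -/
noncomputable def outDegree {V : Type*} (G : SimpleGraph V) (A : Set V) (x : V) : ℕ :=
  {y | G.Adj x y ∧ y ∉ A}.ncard

/-- The degree of a vertex of `A` in the subgraph of `G` induced by `A`. -/
noncomputable def inducedDegree {V : Type*} (G : SimpleGraph V) (A : Set V) (x : A) : ℕ :=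
  ((G.induce A).neighborSet x).ncard

/-!
For `f ≥ 0` supported on `A`, induction on the dimension `n` shows that
`log₂ (2 ^ n / |A|) * (∑ f) ^ 2 / |A|` is at most the Dirichlet energy of `f`. The indicator of `A`
has energy `|∂A|`, so by assumption it is nearly extremal. Applying the inequality to the
perturbation `1_A * (1 - g)` with `g = (d_out - L) / (2 * n)`, where `L = log₂ (2 ^ n / |A|)`, and
bounding the energy of `1_A * g` by `2 * n * ∑_A g ^ 2`, the terms of first order in `g` give
`∑_A (d_out - L) ^ 2 ≤ 2 * n * (|∂A| - L * |A|)`. Chebyshev's inequality concludes.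
-/

open Finset Real
open scoped Matrix

theorem add_sq_div_add_le {p q : ℝ} (hp : 0 < p) (hq : 0 < q) (u v : ℝ) :
    (u + v) ^ 2 / (p + q) ≤ u ^ 2 / p + v ^ 2 / q := by
  simpa [Fin.forall_fin_two, hp, hq] using
    Finset.sq_sum_div_le_sum_sq_div univ ![u, v] (g := ![p, q])

theorem le_logb_two_one_add {x : ℝ} (hx₀ : 0 ≤ x) (hx₁ : x ≤ 1) : x ≤ logb 2 (1 + x) := by
  rw [le_logb_iff_rpow_le one_lt_two (by linarith)]
  simpa [one_add_one_eq_two] using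
    rpow_one_add_le_one_add_mul_self (s := 1) (by norm_num) hx₀ hx₁

theorem one_add_logb_two_sub_logb_two_add_le {a b : ℝ} (hb : 0 < b) (hba : b ≤ a) :
    1 + logb 2 a - logb 2 (a + b) ≤ (a - b) / a := by
  have ha : 0 < a := hb.trans_le hba
  have h := le_logb_two_one_add (x := b / a) (by positivity) ((div_le_one ha).2 hba)
  rw [one_add_div ha.ne', logb_div (by positivity) ha.ne'] at h
  rw [sub_div, div_self ha.ne']
  linarith

theorem logb_two_add_logb_two_add_two_le {a b : ℝ} (ha : 0 < a) (hb : 0 < b) :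
    logb 2 a + logb 2 b + 2 ≤ 2 * logb 2 (a + b) := by
  have h : logb 2 (4 * a * b) ≤ logb 2 ((a + b) ^ 2) :=
    logb_le_logb_of_le one_lt_two (by positivity) (four_mul_le_sq_add a b)
  have h₄ : logb 2 4 = 2 := by
    rw [show (4 : ℝ) = 2 ^ 2 by norm_num, logb_pow, logb_self_eq_one one_lt_two]; norm_num
  rw [logb_mul (by positivity) hb.ne', logb_mul (by norm_num) ha.ne', logb_pow, h₄] at h
  push_cast at h
  linarith

theorem two_point_inequality_of_le {a b : ℝ} (hb : 0 < b) (hba : b ≤ a) (s t : ℝ) :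
    (s + t) ^ 2 / (a + b) * (1 + logb 2 a - logb 2 (a + b))
      ≤ t ^ 2 / b * (logb 2 a - logb 2 b) + (s - t) ^ 2 / a := by
  have ha : 0 < a := hb.trans_le hba
  set q := 1 + logb 2 a - logb 2 (a + b) with hq
  have hq_amgm : 2 * q ≤ logb 2 a - logb 2 b := by
    linarith [logb_two_add_logb_two_add_two_le ha hb]
  rcases hba.eq_or_lt with rfl | hlt
  · have : q = 0 := by
      rw [hq, ← two_mul, logb_mul two_ne_zero hb.ne', logb_self_eq_one one_lt_two, sub_self]
    rw [this]
    simp only [mul_zero, sub_self, zero_add]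
    positivity
  have hab : 0 < a - b := sub_pos.2 hlt
  have hq_concave : q ≤ (a - b) / a := one_add_logb_two_sub_logb_two_add_le hb hba
  have hq₀ : 0 ≤ q := by
    have h : logb 2 (a + b) ≤ logb 2 (2 * a) :=
      logb_le_logb_of_le one_lt_two (by positivity) (by linarith)
    rw [logb_mul two_ne_zero ha.ne', logb_self_eq_one one_lt_two] at h
    linarith
  -- Splitting off `a - b` matches the two bounds on `q`: the concavity bound cancels the new
  -- denominator `a - b`, and the AM-GM bound takes the remaining term.
  calc (s + t) ^ 2 / (a + b) * q
      = ((s - t) + 2 * t) ^ 2 / ((a - b) + 2 * b) * q := by ring_nf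
    _ ≤ ((s - t) ^ 2 / (a - b) + (2 * t) ^ 2 / (2 * b)) * q := by
        gcongr
        exact add_sq_div_add_le hab (by positivity) _ _
    _ = t ^ 2 / b * (2 * q) + (s - t) ^ 2 / (a - b) * q := by
        field_simp
        ring
    _ ≤ t ^ 2 / b * (logb 2 a - logb 2 b) + (s - t) ^ 2 / (a - b) * ((a - b) / a) := by gcongr
    _ = t ^ 2 / b * (logb 2 a - logb 2 b) + (s - t) ^ 2 / a := by
        rw [div_mul_div_cancel₀ hab.ne']

theorem two_point_inequality {a b M s t : ℝ} (ha : 0 ≤ a) (hb : 0 ≤ b) (hM : logb 2 (max a b) ≤ M)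
    (hs : a = 0 → s = 0) (ht : b = 0 → t = 0) :
    (s + t) ^ 2 / (a + b) * (M + 1 - logb 2 (a + b))
      ≤ s ^ 2 / a * (M - logb 2 a) + t ^ 2 / b * (M - logb 2 b) + (s - t) ^ 2 / max a b := by
  wlog hba : b ≤ a generalizing a b s t
  · have h := this hb ha (max_comm a b ▸ hM) ht hs (le_of_not_ge hba)
    rw [add_comm t s, add_comm b a, max_comm b a, sub_sq_comm t s] at h
    linarith
  rw [max_eq_left hba] at hM ⊢
  rcases hb.eq_or_lt with rfl | hb
  · rw [ht rfl, add_zero, add_zero, sub_zero]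
    exact le_of_eq (by ring)
  have h₁ := two_point_inequality_of_le hb hba s t
  have h₂ : (s + t) ^ 2 / (a + b) * (M - logb 2 a)
      ≤ (s ^ 2 / a + t ^ 2 / b) * (M - logb 2 a) :=
    mul_le_mul_of_nonneg_right (add_sq_div_add_le (hb.trans_le hba) hb s t) (sub_nonneg.2 hM)
  linarith

theorem sq_sum_sub_sum_le {V : Type*} [Fintype V] {f g : V → ℝ} {A : Finset V}
    (hg : 0 ≤ g) (hf : ∀ x ∉ A, f x = 0) (hgf : ∑ x, g x ≤ ∑ x, f x) :
    (∑ x, f x - ∑ x, g x) ^ 2 ≤ #A * ∑ x, (f x - g x) ^ 2 := by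
  classical
  have hcompl : ∑ x ∈ Aᶜ, (f x - g x) ≤ 0 := sum_nonpos fun x hx => by
    rw [hf x (mem_compl.1 hx), zero_sub]
    exact neg_nonpos.2 (hg x)
  calc (∑ x, f x - ∑ x, g x) ^ 2 ≤ (∑ x ∈ A, (f x - g x)) ^ 2 := by
        gcongr
        rw [← sum_sub_distrib, ← sum_add_sum_compl A]
        linarith
    _ ≤ #A * ∑ x ∈ A, (f x - g x) ^ 2 := sq_sum_le_card_mul_sum_sq
    _ ≤ #A * ∑ x, (f x - g x) ^ 2 := by
        gcongr
        exact A.subset_univ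

theorem sq_sum_sub_sum_div_max_le {V : Type*} [Fintype V] {f g : V → ℝ} {A B : Finset V}
    (hf₀ : 0 ≤ f) (hg₀ : 0 ≤ g) (hf : ∀ x ∉ A, f x = 0) (hg : ∀ x ∉ B, g x = 0) :
    (∑ x, f x - ∑ x, g x) ^ 2 / max (#A : ℝ) #B ≤ ∑ x, (f x - g x) ^ 2 := by
  wlog h : ∑ x, g x ≤ ∑ x, f x generalizing f g A B
  · simpa only [sub_sq_comm, max_comm] using this hg₀ hf₀ hg hf (le_of_not_ge h)
  refine div_le_of_le_mul₀ (by positivity) (sum_nonneg fun x _ => sq_nonneg _) ?_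
  rw [mul_comm]
  exact (sq_sum_sub_sum_le hg₀ hf h).trans <|
    mul_le_mul_of_nonneg_right (le_max_left _ _) (sum_nonneg fun x _ => sq_nonneg _)

section Graph

variable {V : Type*} [Fintype V] (G : SimpleGraph V) [DecidableRel G.Adj]

/-- The Dirichlet energy of `f` on `G`: the sum of `(f x - f y) ^ 2` over unoriented edges, hence
the factor `1 / 2`. -/
noncomputable def dirichletEnergy (f : V → ℝ) : ℝ :=
  (∑ x, ∑ y, if G.Adj x y then (f x - f y) ^ 2 else 0) / 2

/-- The functional edge-isoperimetric inequality with constant `c` for functions supported on `A`.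
For `f` the indicator function of `A` it reads `c * #A ≤ |∂A|`; it bounds the boundary from below
also for nearby weights, which is what makes it useful for stability. -/
def FunctionalIsoperimetry (A : Finset V) (c : ℝ) : Prop :=
  ∀ f : V → ℝ, 0 ≤ f → (∀ x ∉ A, f x = 0) → c * ((∑ x, f x) ^ 2 / #A) ≤ dirichletEnergy G f

theorem dirichletEnergy_eq_dotProduct [DecidableEq V] (f : V → ℝ) :
    dirichletEnergy G f = f ⬝ᵥ G.lapMatrix ℝ *ᵥ f := by
  rw [← Matrix.toLinearMap₂'_apply', G.lapMatrix_toLinearMap₂' ℝ, dirichletEnergy]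

theorem dirichletEnergy_sub [DecidableEq V] (f g : V → ℝ) :
    dirichletEnergy G (f - g)
      = dirichletEnergy G f - 2 * (g ⬝ᵥ G.lapMatrix ℝ *ᵥ f) + dirichletEnergy G g := by
  have hsymm : f ⬝ᵥ G.lapMatrix ℝ *ᵥ g = g ⬝ᵥ G.lapMatrix ℝ *ᵥ f := by
    rw [Matrix.dotProduct_mulVec, ← Matrix.mulVec_transpose, (G.isSymm_lapMatrix (R := ℝ)).eq,
      dotProduct_comm]
  simp only [dirichletEnergy_eq_dotProduct, Matrix.mulVec_sub, dotProduct_sub, sub_dotProduct,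
    hsymm]
  ring

variable {G} in
theorem dirichletEnergy_le {d : ℕ} (hd : ∀ x, G.degree x ≤ d) (f : V → ℝ) :
    dirichletEnergy G f ≤ 2 * d * ∑ x, f x ^ 2 := by
  have hdeg : ∑ x, ∑ y, (if G.Adj x y then f x ^ 2 else 0) ≤ d * ∑ x, f x ^ 2 := by
    rw [mul_sum]
    gcongr with x
    rw [← sum_filter, sum_const, nsmul_eq_mul, ← G.neighborFinset_eq_filter,
      G.card_neighborFinset_eq_degree]
    gcongr
    exact hd x
  have hswap : ∑ x, ∑ y, (if G.Adj x y then f y ^ 2 else 0)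
      = ∑ x, ∑ y, if G.Adj x y then f x ^ 2 else 0 := by
    rw [sum_comm]
    simp only [G.adj_comm]
  have hedge : ∑ x, ∑ y, (if G.Adj x y then (f x - f y) ^ 2 else 0)
      ≤ ∑ x, ∑ y, (2 * (if G.Adj x y then f x ^ 2 else 0)
        + 2 * if G.Adj x y then f y ^ 2 else 0) := by
    gcongr with x _ y
    split_ifs
    · nlinarith [sq_nonneg (f x + f y)]
    · simp
  simp only [sum_add_distrib, ← mul_sum, hswap] at hedge
  rw [dirichletEnergy]
  linarith

theorem outDegree_eq_card_sdiff [DecidableEq V] (A : Finset V) (x : V) :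
    outDegree G A x = #(G.neighborFinset x \ A) := by
  rw [outDegree, ← Set.ncard_coe_finset]
  congr 1
  ext y
  simp

theorem inducedDegree_eq_card_inter [DecidableEq V] (A : Finset V) (x : (A : Set V)) :
    inducedDegree G A x = #(G.neighborFinset x ∩ A) := by
  rw [inducedDegree, ← Set.ncard_coe_finset, ← Set.ncard_image_of_injective _ Subtype.val_injective]
  congr 1
  ext y
  simp [and_comm]

theorem inducedDegree_add_outDegree (A : Finset V) (x : (A : Set V)) :
    inducedDegree G A x + outDegree G A x = G.degree x := by
  classical
  rw [inducedDegree_eq_card_inter, outDegree_eq_card_sdiff, card_inter_add_card_sdiff,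
    G.card_neighborFinset_eq_degree]

theorem outDegree_le_degree (A : Finset V) (x : V) : outDegree G A x ≤ G.degree x := by
  classical
  rw [outDegree_eq_card_sdiff]
  exact card_le_card sdiff_subset

theorem edgeBoundary_eq_image_interedges [DecidableEq V] (A : Finset V) :
    edgeBoundary G A = (G.interedges A Aᶜ).image fun p => s(p.1, p.2) := by
  ext e
  simp only [edgeBoundary, Set.mem_ofPred_eq, mem_coe, mem_image, Prod.exists,
    SimpleGraph.mk_mem_interedges_iff, mem_compl]
  constructor
  · rintro ⟨he, x, hx, y, hy, rfl⟩
    exact ⟨x, y, ⟨hx, hy, he⟩, rfl⟩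
  · rintro ⟨x, y, ⟨hx, hy, he⟩, rfl⟩
    exact ⟨he, x, hx, y, hy, rfl⟩

theorem card_interedges_compl [DecidableEq V] (A : Finset V) :
    #(G.interedges A Aᶜ) = ∑ x ∈ A, outDegree G A x := by
  rw [SimpleGraph.interedges_def, card_filter, sum_product]
  refine sum_congr rfl fun x _ => ?_
  rw [outDegree_eq_card_sdiff, ← card_filter]
  congr 1
  ext y
  simp [and_comm]

theorem ncard_edgeBoundary {V : Type*} [Finite V] (G : SimpleGraph V) (A : Finset V) :
    (edgeBoundary G A).ncard = ∑ x ∈ A, outDegree G A x := by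
  classical
  have := Fintype.ofFinite V
  rw [edgeBoundary_eq_image_interedges, Set.ncard_coe_finset, ← card_interedges_compl]
  refine card_image_of_injOn ?_
  rintro ⟨x, y⟩ hxy ⟨x', y'⟩ hxy' h
  simp only [mem_coe, SimpleGraph.mk_mem_interedges_iff, mem_compl] at hxy hxy'
  rcases Sym2.eq_iff.1 h with ⟨rfl, rfl⟩ | ⟨rfl, -⟩
  · rfl
  · exact absurd hxy.1 hxy'.2.1

theorem lapMatrix_mulVec_indicator [DecidableEq V] {A : Finset V} {x : V} (hx : x ∈ A) :
    (G.lapMatrix ℝ *ᵥ (A : Set V).indicator 1) x = outDegree G A x := by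
  rw [G.lapMatrix_mulVec_apply, Set.indicator_of_mem (mem_coe.2 hx), outDegree_eq_card_sdiff,
    ← G.card_neighborFinset_eq_degree, ← card_sdiff_add_card_inter _ A]
  simp [Set.indicator_apply, -card_sdiff_add_card_inter]

theorem indicator_dotProduct_lapMatrix_mulVec_indicator [DecidableEq V] (A : Finset V) (g : V → ℝ) :
    (A : Set V).indicator g ⬝ᵥ G.lapMatrix ℝ *ᵥ (A : Set V).indicator 1
      = ∑ x ∈ A, g x * outDegree G A x := by
  rw [dotProduct, ← sum_subset A.subset_univ fun x _ hx => by simp [hx]]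
  refine sum_congr rfl fun x hx => ?_
  rw [lapMatrix_mulVec_indicator G hx, Set.indicator_of_mem (mem_coe.2 hx)]

theorem dirichletEnergy_indicator_one (A : Finset V) :
    dirichletEnergy G ((A : Set V).indicator 1) = ∑ x ∈ A, (outDegree G A x : ℝ) := by
  classical
  simp [dirichletEnergy_eq_dotProduct, indicator_dotProduct_lapMatrix_mulVec_indicator]

variable {G}

theorem dirichletEnergy_indicator_one_sub_le {d : ℕ} (hd : ∀ x, G.degree x ≤ d) (A : Finset V)
    (g : V → ℝ) :
    dirichletEnergy G ((A : Set V).indicator (1 - g))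
      ≤ ∑ x ∈ A, (outDegree G A x : ℝ) - 2 * ∑ x ∈ A, g x * outDegree G A x
        + 2 * d * ∑ x ∈ A, g x ^ 2 := by
  classical
  have hsq : ∑ x, (A : Set V).indicator g x ^ 2 = ∑ x ∈ A, g x ^ 2 := by
    rw [← Finset.sum_indicator_subset _ A.subset_univ]
    refine sum_congr rfl fun x _ => ?_
    by_cases hx : x ∈ A <;> simp [hx]
  rw [Set.indicator_sub', dirichletEnergy_sub, dirichletEnergy_indicator_one,
    indicator_dotProduct_lapMatrix_mulVec_indicator, ← hsq]
  gcongr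
  exact dirichletEnergy_le hd _

theorem FunctionalIsoperimetry.mul_sub_le {A : Finset V} (hA : A.Nonempty) {c : ℝ}
    (hiso : FunctionalIsoperimetry G A c) (hc : 0 ≤ c) {d : ℕ} (hd : ∀ x, G.degree x ≤ d)
    {g : V → ℝ} (hg : g ≤ 1) :
    c * (#A - 2 * ∑ x ∈ A, g x)
      ≤ ∑ x ∈ A, (outDegree G A x : ℝ) - 2 * ∑ x ∈ A, g x * outDegree G A x
        + 2 * d * ∑ x ∈ A, g x ^ 2 := by
  have hA_pos : (0 : ℝ) < #A := by exact_mod_cast hA.card_pos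
  have hmass : ∑ x, (A : Set V).indicator (1 - g) x = #A - ∑ x ∈ A, g x := by
    simp [Finset.sum_indicator_subset]
  calc c * (#A - 2 * ∑ x ∈ A, g x)
      ≤ c * ((#A - ∑ x ∈ A, g x) ^ 2 / #A) := by
        gcongr
        rw [le_div_iff₀ hA_pos]
        linarith [sq_nonneg (∑ x ∈ A, g x)]
    _ ≤ dirichletEnergy G ((A : Set V).indicator (1 - g)) := by
        rw [← hmass]
        exact hiso _ (Set.indicator_nonneg fun x _ => sub_nonneg.2 (hg x)) fun x hx => by simp [hx]
    _ ≤ _ := dirichletEnergy_indicator_one_sub_le hd A g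

theorem FunctionalIsoperimetry.sum_sq_outDegree_sub_le {A : Finset V} (hA : A.Nonempty) {c : ℝ}
    (hiso : FunctionalIsoperimetry G A c) (hc : 0 ≤ c) {d : ℕ} (hd₀ : 0 < d)
    (hd : ∀ x, G.degree x ≤ d) :
    ∑ x ∈ A, ((outDegree G A x : ℝ) - c) ^ 2 ≤ 2 * d * ((edgeBoundary G A).ncard - c * #A) := by
  have hd_pos : (0 : ℝ) < d := by exact_mod_cast hd₀
  set g : V → ℝ := fun x => ((outDegree G A x : ℝ) - c) / (2 * d) with hg
  have hg_le : g ≤ 1 := fun x => by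
    have : (outDegree G A x : ℝ) ≤ d := by exact_mod_cast (outDegree_le_degree G A x).trans (hd x)
    rw [hg, Pi.one_apply, div_le_one (by positivity)]
    linarith
  have houtDegree (x : V) : (outDegree G A x : ℝ) = c + 2 * d * g x := by
    rw [hg]
    field_simp
    ring
  have hcross : ∑ x ∈ A, g x * outDegree G A x = c * ∑ x ∈ A, g x + 2 * d * ∑ x ∈ A, g x ^ 2 := by
    simp only [houtDegree, mul_sum, ← sum_add_distrib]
    exact sum_congr rfl fun x _ => by ring
  have hsecond : ∑ x ∈ A, ((outDegree G A x : ℝ) - c) ^ 2 = (2 * d) ^ 2 * ∑ x ∈ A, g x ^ 2 := by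
    simp only [houtDegree, add_sub_cancel_left, mul_pow, mul_sum]
  have hpert := hiso.mul_sub_le hA hc hd hg_le
  rw [hcross] at hpert
  rw [hsecond, ncard_edgeBoundary, Nat.cast_sum, sq, mul_assoc]
  gcongr
  linarith

end Graph

theorem uniformOn_real_eq_card_filter_div_card {Ω : Type*} [MeasurableSpace Ω]
    [MeasurableSingletonClass Ω] (S : Finset Ω) (T : Set Ω) [DecidablePred (· ∈ T)] :
    (ProbabilityTheory.uniformOn (S : Set Ω)).real T = (#{x ∈ S | x ∈ T} : ℝ) / #S := by
  classical
  rw [MeasureTheory.measureReal_def, ← ProbabilityTheory.uniformOn_inter_self S.finite_toSet,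
    show (S : Set Ω) ∩ T = ({x ∈ S | x ∈ T} : Finset Ω) by ext; simp,
    ProbabilityTheory.uniformOn_apply_finset, inter_eq_right.2 (filter_subset _ _)]
  simp

theorem uniformOn_real_mono {Ω : Type*} [MeasurableSpace Ω] [MeasurableSingletonClass Ω]
    {S : Finset Ω} {T U : Set Ω} (h : ∀ x ∈ S, x ∈ T → x ∈ U) :
    (ProbabilityTheory.uniformOn (S : Set Ω)).real T
      ≤ (ProbabilityTheory.uniformOn (S : Set Ω)).real U := by
  classical
  simp only [uniformOn_real_eq_card_filter_div_card]
  gcongr ?_ / _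
  refine Nat.cast_le.2 <| card_le_card fun x hx => ?_
  rw [mem_filter] at hx ⊢
  exact ⟨hx.1, h x hx.1 hx.2⟩

theorem card_filter_lt_abs_sub_le {Ω : Type*} {S : Finset Ω} {f : Ω → ℝ} {m r κ : ℝ}
    (hr : 0 ≤ r) (hκ : 0 ≤ κ) (hf : ∑ x ∈ S, (f x - m) ^ 2 ≤ κ * #S * r ^ 2) :
    (#{x ∈ S | r < |f x - m|} : ℝ) ≤ κ * #S := by
  have hle_sq {x : Ω} (hx : x ∈ S) : (f x - m) ^ 2 ≤ κ * #S * r ^ 2 :=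
    (single_le_sum (f := fun x => (f x - m) ^ 2) (fun _ _ => sq_nonneg _) hx).trans hf
  rcases hr.eq_or_lt with rfl | hr
  · rw [filter_false_of_mem fun x hx => ?_]
    · simp only [card_empty, Nat.cast_zero]
      positivity
    · have := hle_sq hx
      rw [zero_pow two_ne_zero, mul_zero] at this
      simp [pow_eq_zero_iff two_ne_zero |>.1 (this.antisymm (sq_nonneg _))]
  · refine le_of_mul_le_mul_right (le_trans ?_ hf) (pow_pos hr 2)
    calc (#{x ∈ S | r < |f x - m|} : ℝ) * r ^ 2
        ≤ ∑ x ∈ S with r < |f x - m|, (f x - m) ^ 2 := by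
          rw [← nsmul_eq_mul]
          refine card_nsmul_le_sum _ _ _ fun x hx => ?_
          rw [← sq_abs (f x - m)]
          have := (mem_filter.1 hx).2.le
          gcongr
      _ ≤ ∑ x ∈ S, (f x - m) ^ 2 :=
          sum_le_sum_of_subset_of_nonneg (filter_subset _ _) fun _ _ _ => sq_nonneg _

theorem one_sub_le_uniformOn_real_abs_sub_le {Ω : Type*} [MeasurableSpace Ω]
    [MeasurableSingletonClass Ω] {S : Finset Ω} (hS : S.Nonempty) {f : Ω → ℝ} {m r κ : ℝ}
    (hr : 0 ≤ r) (hκ : 0 ≤ κ) (hf : ∑ x ∈ S, (f x - m) ^ 2 ≤ κ * #S * r ^ 2) :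
    1 - κ ≤ (ProbabilityTheory.uniformOn (S : Set Ω)).real {x | |f x - m| ≤ r} := by
  classical
  have hS_pos : (0 : ℝ) < #S := by exact_mod_cast hS.card_pos
  have hsplit : (#{x ∈ S | |f x - m| ≤ r} : ℝ) + #{x ∈ S | r < |f x - m|} = #S := by
    simpa only [not_le] using
      (mod_cast card_filter_add_card_filter_not (s := S) (|f · - m| ≤ r) :
        (#{x ∈ S | |f x - m| ≤ r} : ℝ) + #{x ∈ S | ¬ |f x - m| ≤ r} = #S)
  rw [uniformOn_real_eq_card_filter_div_card, le_div_iff₀ hS_pos]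
  simp only [Set.mem_ofPred_eq]
  linarith [card_filter_lt_abs_sub_le hr hκ hf]

theorem FunctionalIsoperimetry.one_sub_div_sq_le_uniformOn_real {V : Type*} [Fintype V]
    [MeasurableSpace V] [MeasurableSingletonClass V] {G : SimpleGraph V} [DecidableRel G.Adj]
    {A : Finset V} (hA : A.Nonempty) {c : ℝ} (hiso : FunctionalIsoperimetry G A c) (hc : 0 ≤ c)
    {d : ℕ} (hd₀ : 0 < d) (hd : ∀ x, G.degree x ≤ d) {ε δ : ℝ} (hε : 0 ≤ ε) (hδ : 0 < δ)
    (hbd : ((edgeBoundary G A).ncard : ℝ) ≤ (1 + ε / (2 * d) * c) * (#A * c)) :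
    1 - ε / δ ^ 2
      ≤ (ProbabilityTheory.uniformOn (A : Set V)).real
          {x | |(outDegree G A x : ℝ) - c| ≤ δ * c} := by
  refine one_sub_le_uniformOn_real_abs_sub_le hA (by positivity) (by positivity) ?_
  calc ∑ x ∈ A, ((outDegree G A x : ℝ) - c) ^ 2
      ≤ 2 * d * ((edgeBoundary G A).ncard - c * #A) :=
        hiso.sum_sq_outDegree_sub_le hA hc hd₀ hd
    _ ≤ 2 * d * ((1 + ε / (2 * d) * c) * (#A * c) - c * #A) := by gcongr
    _ = ε / δ ^ 2 * #A * (δ * c) ^ 2 := by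
        field_simp
        ring

section Cube

variable {n : ℕ}

instance cubeGraph.decidableRelAdj : DecidableRel (cubeGraph n).Adj :=
  fun x y => decEq (hammingDist x y) 1

theorem cubeGraph_adj_cons {a b : Bool} {x y : Fin n → Bool} :
    (cubeGraph (n + 1)).Adj (Fin.cons a x) (Fin.cons b y)
      ↔ a = b ∧ (cubeGraph n).Adj x y ∨ a ≠ b ∧ x = y := by
  have hdist : hammingDist (Fin.cons a x : Fin (n + 1) → Bool) (Fin.cons b y)
      = (if a ≠ b then 1 else 0) + hammingDist x y := by
    rw [hammingDist, Fin.card_filter_univ_succ']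
    simp [hammingDist]
  simp only [cubeGraph, hdist]
  by_cases hab : a = b <;> simp [hab]

theorem sum_cube_succ (F : (Fin (n + 1) → Bool) → ℝ) :
    ∑ x, F x = ∑ y : Fin n → Bool, F (Fin.cons false y)
      + ∑ y : Fin n → Bool, F (Fin.cons true y) := by
  rw [← (Fin.consEquiv fun _ => Bool).sum_comp, Fintype.sum_prod_type]
  simp [Fin.consEquiv, add_comm]

theorem degree_cubeGraph (x : Fin n → Bool) : (cubeGraph n).degree x = n := by
  have hcast : ((cubeGraph n).degree x : ℝ) = n := by
    induction n with
    | zero => simp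
    | succ n ih =>
      rw [← Fin.cons_self_tail x, SimpleGraph.degree_eq_sum_if_adj, sum_cube_succ]
      rcases x 0 <;>
        simp [cubeGraph_adj_cons, ← ih (Fin.tail x), SimpleGraph.degree_eq_sum_if_adj, add_comm]
  exact_mod_cast hcast

theorem dirichletEnergy_cubeGraph_succ (f : (Fin (n + 1) → Bool) → ℝ) :
    dirichletEnergy (cubeGraph (n + 1)) f
      = dirichletEnergy (cubeGraph n) (fun y => f (Fin.cons false y))
        + dirichletEnergy (cubeGraph n) (fun y => f (Fin.cons true y))
        + ∑ y : Fin n → Bool, (f (Fin.cons false y) - f (Fin.cons true y)) ^ 2 := by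
  have hswap : ∑ y : Fin n → Bool, (f (Fin.cons true y) - f (Fin.cons false y)) ^ 2
      = ∑ y : Fin n → Bool, (f (Fin.cons false y) - f (Fin.cons true y)) ^ 2 :=
    sum_congr rfl fun y _ => sub_sq_comm _ _
  simp only [dirichletEnergy, sum_cube_succ, sum_add_distrib, cubeGraph_adj_cons, true_and, ne_eq,
    not_true_eq_false, false_and, or_false, Bool.true_eq_false, not_false_eq_true, false_or,
    sum_ite_eq, mem_univ, ↓reduceIte, hswap, Bool.false_eq_true]
  ring

theorem logb_two_card_le (A : Finset (Fin n → Bool)) : logb 2 #A ≤ n := by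
  rcases A.eq_empty_or_nonempty with rfl | hA
  · simp
  have hcard : (#A : ℝ) ≤ 2 ^ n := by exact_mod_cast A.card_le_univ.trans_eq (by simp)
  have hA_pos : (0 : ℝ) < #A := by exact_mod_cast hA.card_pos
  rw [logb_le_iff_le_rpow one_lt_two hA_pos]
  exact_mod_cast hcard

theorem logb_two_two_pow_div_card {A : Finset (Fin n → Bool)} (hA : A.Nonempty) :
    logb 2 (2 ^ n / #A) = n - logb 2 #A := by
  rw [logb_div (by positivity) (by exact_mod_cast hA.card_ne_zero), logb_pow,
    logb_self_eq_one one_lt_two, mul_one]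

theorem functionalIsoperimetry_cubeGraph (A : Finset (Fin n → Bool)) :
    FunctionalIsoperimetry (cubeGraph n) A (n - logb 2 #A) := by
  intro f hf₀ hf
  induction n with
  | zero =>
    have hcard : #A ≤ 1 := by simpa using A.card_le_univ
    have henergy : dirichletEnergy (cubeGraph 0) f = 0 := by simp [dirichletEnergy]
    interval_cases #A <;> simp [henergy]
  | succ n ih =>
    set B : Bool → Finset (Fin n → Bool) :=
      fun b => {y | (Fin.cons b y : Fin (n + 1) → Bool) ∈ A} with hB
    set g : Bool → (Fin n → Bool) → ℝ := fun b y => f (Fin.cons b y)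
    have hg₀ (b : Bool) : 0 ≤ g b := fun y => hf₀ _
    have hgB (b : Bool) : ∀ y ∉ B b, g b y = 0 := fun y hy => hf _ (by simpa [hB] using hy)
    have hsum_zero (b : Bool) (h : (#(B b) : ℝ) = 0) : ∑ y, g b y = 0 :=
      sum_eq_zero fun y _ => hgB b y <| by simp [card_eq_zero.1 (Nat.cast_eq_zero.1 h)]
    have hcard : (#A : ℝ) = #(B false) + #(B true) := by
      simpa [hB] using sum_cube_succ fun x => if x ∈ A then (1 : ℝ) else 0
    have hlog_max : logb 2 (max (#(B false) : ℝ) #(B true)) ≤ n := by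
      rcases max_choice (#(B false) : ℝ) #(B true) with h | h <;> rw [h] <;>
        exact logb_two_card_le _
    have hpoint := two_point_inequality (Nat.cast_nonneg _) (Nat.cast_nonneg _) hlog_max
      (hsum_zero false) (hsum_zero true)
    have hdiff := sq_sum_sub_sum_div_max_le (hg₀ false) (hg₀ true) (hgB false) (hgB true)
    have hfalse := ih (B false) (g false) (hg₀ false) (hgB false)
    have htrue := ih (B true) (g true) (hg₀ true) (hgB true)
    rw [dirichletEnergy_cubeGraph_succ, sum_cube_succ, hcard, Nat.cast_succ, mul_comm]
    linarith

end Cube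

theorem corollary3p2_general (n : ℕ) (hn : 1 ≤ n)
    (A : Set (Fin n → Bool)) (hA : A.Nonempty)
    (ε ε' δ : ℝ) (hε'0 : 0 ≤ ε') (hδ0 : 0 < δ)
    (hε : ε = ε' / (2 * n) * Real.logb 2 (2 ^ n / A.ncard))
    (hbd : ((edgeBoundary (cubeGraph n) A).ncard : ℝ)
      ≤ (1 + ε) * (A.ncard * Real.logb 2 (2 ^ n / A.ncard))) :
    1 - ε' / δ ^ 2 ≤ (ProbabilityTheory.uniformOn A).real
        {x | (1 - δ) * Real.logb 2 (2 ^ n / A.ncard) ≤ outDegree (cubeGraph n) A x ∧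
          (outDegree (cubeGraph n) A x : ℝ)
            ≤ (1 + ε) * (1 + δ) * Real.logb 2 (2 ^ n / A.ncard)} ∧
    1 - ε' / δ ^ 2 ≤ (ProbabilityTheory.uniformOn A).real
        {x | ∃ hx : x ∈ A,
          Real.logb 2 A.ncard - ((1 + ε) * (1 + δ) - 1) * Real.logb 2 (2 ^ n / A.ncard)
            ≤ inducedDegree (cubeGraph n) A ⟨x, hx⟩ ∧
          (inducedDegree (cubeGraph n) A ⟨x, hx⟩ : ℝ)
            ≤ Real.logb 2 A.ncard + δ * Real.logb 2 (2 ^ n / A.ncard)} := by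
  lift A to Finset (Fin n → Bool) using A.toFinite
  rw [Finset.coe_nonempty] at hA
  simp only [Set.ncard_coe_finset] at hε hbd ⊢
  have hL := logb_two_two_pow_div_card hA
  set L := logb 2 (2 ^ n / (#A : ℝ))
  have hL₀ : 0 ≤ L := hL ▸ sub_nonneg.2 (logb_two_card_le A)
  have hiso : FunctionalIsoperimetry (cubeGraph n) A L := hL ▸ functionalIsoperimetry_cubeGraph A
  have hconc := hiso.one_sub_div_sq_le_uniformOn_real hA hL₀ hn
    (fun x => (degree_cubeGraph x).le) hε'0 hδ0 (hε ▸ hbd)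
  have hupper : (1 + δ) * L ≤ (1 + ε) * (1 + δ) * L := by
    have hε₀ : 0 ≤ ε := hε ▸ by positivity
    gcongr
    exact le_mul_of_one_le_left (by positivity) (by linarith)
  refine ⟨hconc.trans <| uniformOn_real_mono fun x _ hx => ?_,
    hconc.trans <| uniformOn_real_mono fun x hxA hx => ⟨hxA, ?_⟩⟩ <;>
    rw [Set.mem_ofPred_eq, abs_le] at hx
  · constructor <;> linarith
  · have hdeg : (inducedDegree (cubeGraph n) A ⟨x, hxA⟩ : ℝ) + outDegree (cubeGraph n) A x = n := by
      exact_mod_cast (inducedDegree_add_outDegree _ A ⟨x, hxA⟩).trans (degree_cubeGraph x)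
    constructor <;> linarith

theorem corollary3p2 (n : ℕ) (hn : 1 ≤ n)
    (A : Set (Fin n → Bool)) (hA : A.Nonempty)
    (ε ε' δ : ℝ) (hε'0 : 0 ≤ ε') (hε'1 : ε' ≤ 1) (hδ0 : 0 < δ) (hδ1 : δ ≤ 1)
    (hε : ε = ε' / (2 * n) * Real.logb 2 (2 ^ n / A.ncard))
    (hbd : ((edgeBoundary (cubeGraph n) A).ncard : ℝ)
      ≤ (1 + ε) * (A.ncard * Real.logb 2 (2 ^ n / A.ncard))) :
    1 - ε' / δ ^ 2 ≤ (ProbabilityTheory.uniformOn A).real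
        {x | (1 - δ) * Real.logb 2 (2 ^ n / A.ncard) ≤ outDegree (cubeGraph n) A x ∧
          (outDegree (cubeGraph n) A x : ℝ)
            ≤ (1 + ε) * (1 + δ) * Real.logb 2 (2 ^ n / A.ncard)} ∧
    1 - ε' / δ ^ 2 ≤ (ProbabilityTheory.uniformOn A).real
        {x | ∃ hx : x ∈ A,
          Real.logb 2 A.ncard - ((1 + ε) * (1 + δ) - 1) * Real.logb 2 (2 ^ n / A.ncard)
            ≤ inducedDegree (cubeGraph n) A ⟨x, hx⟩ ∧
          (inducedDegree (cubeGraph n) A ⟨x, hx⟩ : ℝ)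
            ≤ Real.logb 2 A.ncard + δ * Real.logb 2 (2 ^ n / A.ncard)} :=
  corollary3p2_general n hn A hA ε ε' δ hε'0 hδ0 hε hbd
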